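/- Let $d\ge 1$ and let $\xi=(\xi(x))_{x\in\mathbb{R}^d}$ be a real-valued, square-integrable, zero-mean process on a probability space $(\Omega,\mathcal{A},\mathbb{P})$, with continuous covariance function $k(x,y)=\mathbb{E}[\xi(x)\xi(y)]$. For a sequence $(x_n)_{n\ge1}$ in $\mathbb{R}^d$ and $x\in\mathbb{R}^d$, let $\hat\xi(x;\underline{x}_n)$ be the orthogonal projection in $L^2(\Omega,\mathcal{A},\mathbb{P})$ of $\xi(x)$ onto $\mathrm{span}\{\xi(x_1),\dots,\xi(x_n)\}$, and let $\sigma^2(x;\underline{x}_n)=\mathrm{var}[\xi(x)-\hat\xi(x;\underline{x}_n)]$ be the kriging variance. The process $\xi$ has the No-Empty-Ball (NEB) property if, for all sequences $(x_n)_{n\ge1}$ in $\mathbb{R}^d$ and all $x\in\mathbb{R}^d$, the point $x$ belongs to the closure of $\{x_n,\ n\ge1\}$ if and only if $\sigma^2(x;\underline{x}_n)\to0$ as $n\to\infty$. (i) Suppose that $\xi$ is second-order stationary and has a spectral density $S$, that is, a nonnegative integrable function on $\mathbb{R}^d$ with $k(x,y)=(2\pi)^{-d}\int_{\mathbb{R}^d}e^{i\langle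 u,x-y\rangle}S(u)\,du$ for all $x,y\in\mathbb{R}^d$, and that there exist $C>0$ and an integer $r\ge1$ such that $S(u)(1+|u|^r)\ge C$ for almost every $u\in\mathbb{R}^d$. Then $\xi$ has the NEB property. (ii) Suppose that $k(x,y)=s^2e^{-\alpha\|x-y\|^2}$ for some $s>0$ and $\alpha>0$. Then $\xi$ does not have the NEB property. In fact, for every sequence $(x_n)_{n\ge1}$ in $\mathbb{R}^d$ such that the closure of $\{x_n,\ n\ge1\}$ has nonempty interior, $\sigma^2(x;\underline{x}_n)\to0$ for every $x\in\mathbb{R}^d$. -/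

import Mathlib

open MeasureTheory ProbabilityTheory Filter Topology

noncomputable section

namespace Kriging

/-- A family `ξ` of real random variables indexed by `ℝ^d` is a centered second-order process:
every `ξ x` is square integrable and has mean zero. -/
structure IsCenteredSecondOrder {d : ℕ} {Ω : Type*} [MeasurableSpace Ω] (P : Measure Ω)
    (ξ : EuclideanSpace ℝ (Fin d) → Ω → ℝ) : Prop where
  memLp : ∀ x, MemLp (ξ x) 2 P
  mean_zero : ∀ x, ∫ ω, ξ x ω ∂P = 0

/-- The covariance function `k(x, y) = E[ξ(x) ξ(y)]` of a centered second-order process. -/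
def covFun {d : ℕ} {Ω : Type*} [MeasurableSpace Ω] (P : Measure Ω)
    (ξ : EuclideanSpace ℝ (Fin d) → Ω → ℝ) (x y : EuclideanSpace ℝ (Fin d)) : ℝ :=
  ∫ ω, ξ x ω * ξ y ω ∂P

/-- The span in `L²(Ω, P)` of the first `n` observations `ξ(x₀), …, ξ(x_{n-1})`. -/
def obsSpan {d : ℕ} {Ω : Type*} [MeasurableSpace Ω] {P : Measure Ω}
    {ξ : EuclideanSpace ℝ (Fin d) → Ω → ℝ} (hξ : IsCenteredSecondOrder P ξ)
    (xs : ℕ → EuclideanSpace ℝ (Fin d)) (n : ℕ) : Submodule ℝ (Lp ℝ 2 P) :=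
  Submodule.span ℝ (Set.range fun i : Fin n => (hξ.memLp (xs i)).toLp (ξ (xs i)))

instance {d : ℕ} {Ω : Type*} [MeasurableSpace Ω] {P : Measure Ω}
    {ξ : EuclideanSpace ℝ (Fin d) → Ω → ℝ} (hξ : IsCenteredSecondOrder P ξ)
    (xs : ℕ → EuclideanSpace ℝ (Fin d)) (n : ℕ) : FiniteDimensional ℝ (obsSpan hξ xs n) :=
  FiniteDimensional.span_of_finite ℝ (Set.finite_range _)

/-- The kriging predictor of `ξ(x)`: the orthogonal projection in `L²(Ω, P)` of `ξ(x)` onto the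
span of the first `n` observations. -/
def krigingPredictor {d : ℕ} {Ω : Type*} [MeasurableSpace Ω] {P : Measure Ω}
    {ξ : EuclideanSpace ℝ (Fin d) → Ω → ℝ} (hξ : IsCenteredSecondOrder P ξ)
    (xs : ℕ → EuclideanSpace ℝ (Fin d)) (n : ℕ) (x : EuclideanSpace ℝ (Fin d)) : Lp ℝ 2 P :=
  (obsSpan hξ xs n).starProjection ((hξ.memLp x).toLp (ξ x))

/-- The kriging variance at `x` given the first `n` observations: the variance of the prediction
error. -/
def krigingVariance {d : ℕ} {Ω : Type*} [MeasurableSpace Ω] {P : Measure Ω}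
    {ξ : EuclideanSpace ℝ (Fin d) → Ω → ℝ} (hξ : IsCenteredSecondOrder P ξ)
    (xs : ℕ → EuclideanSpace ℝ (Fin d)) (n : ℕ) (x : EuclideanSpace ℝ (Fin d)) : ℝ :=
  variance (fun ω => ξ x ω - krigingPredictor hξ xs n x ω) P

/-- The No-Empty-Ball property: for every sequence of evaluation points and every `x`, the point
`x` is adherent to the sequence if and only if the kriging variance at `x` tends to zero. -/
def NoEmptyBall {d : ℕ} {Ω : Type*} [MeasurableSpace Ω] {P : Measure Ω}
    {ξ : EuclideanSpace ℝ (Fin d) → Ω → ℝ} (hξ : IsCenteredSecondOrder P ξ) : Prop :=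
  ∀ (xs : ℕ → EuclideanSpace ℝ (Fin d)) (x : EuclideanSpace ℝ (Fin d)),
    x ∈ closure (Set.range xs) ↔
      Tendsto (fun n => krigingVariance hξ xs n x) atTop (𝓝 0)

/-- Translation invariance of a covariance function; for a centered process this is second-order
stationarity. -/
def IsStationaryCov {d : ℕ}
    (k : EuclideanSpace ℝ (Fin d) → EuclideanSpace ℝ (Fin d) → ℝ) : Prop :=
  ∀ x y h, k (x + h) (y + h) = k x y

/-- `S` is a spectral density of the covariance function `k`: it is nonnegative and integrable, and
`k(x, y) = (2π)^{-d} ∫ e^{i⟨u, x - y⟩} S(u) du`. -/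
structure IsSpectralDensity {d : ℕ}
    (k : EuclideanSpace ℝ (Fin d) → EuclideanSpace ℝ (Fin d) → ℝ)
    (S : EuclideanSpace ℝ (Fin d) → ℝ) : Prop where
  nonneg : ∀ᵐ u, 0 ≤ S u
  integrable : Integrable S
  eq_integral : ∀ x y, (k x y : ℂ) =
    (((2 * Real.pi) ^ d)⁻¹ : ℝ) *
      ∫ u, Complex.exp (Complex.I * (inner ℝ u (x - y) : ℝ)) * (S u : ℂ)

/-- The inverse of `S` has at most polynomial growth: `S(u) (1 + |u|^r) ≥ C` for almost all `u`,
for some `C > 0` and some integer `r ≥ 1`. -/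
def InvPolynomialGrowth {d : ℕ} (S : EuclideanSpace ℝ (Fin d) → ℝ) : Prop :=
  ∃ C : ℝ, 0 < C ∧ ∃ r : ℕ, 1 ≤ r ∧ ∀ᵐ u, C ≤ S u * (1 + ‖u‖ ^ r)

/-- The Gaussian covariance `k(x, y) = s² exp(-α ‖x - y‖²)`. -/
def gaussianCov {d : ℕ} (s α : ℝ) (x y : EuclideanSpace ℝ (Fin d)) : ℝ :=
  s ^ 2 * Real.exp (-α * ‖x - y‖ ^ 2)

end Kriging

end

/-! The kriging variance is the squared `L²` distance from `ξ(x)` to the span of the observations,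
so it tends to zero exactly when `ξ(x)` lies in the closed span of all of them
(`tendsto_krigingVariance_iff`). Both parts become questions about that closed span.

(i) An adherent point is handled by `L²` continuity of the process. Conversely, if no observation
lies within `ε` of `x`, a prediction error corresponds to a trigonometric polynomial `T` in `L²(S)`,
up to a power of `2π`. Write a smooth bump at `x`, vanishing at distance at least `ε`, as a
superposition of plane waves with Schwartz amplitude `g`. Then `∫ g T = 1`, since the bump is 1 at
`x` and 0 at every observation. As `1/S` grows at most polynomially, `∫ |g|² / S` is finite, and a
Cauchy–Schwarz argument bounds the error below uniformly.

(ii) Along a line the Gaussian process is, up to scalar factors and isometry, the analytic curve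
with kernel `exp (β t s)` in `ℓ²`. A vector orthogonal to a small piece of it is orthogonal to all
of it, so observations dense in a ball determine the process everywhere. -/

namespace Kriging

/-! ### Closed spans and Gram matrices -/

section Gram

variable {ι H₁ H₂ : Type*} [NormedAddCommGroup H₁] [InnerProductSpace ℝ H₁]
  [NormedAddCommGroup H₂] [InnerProductSpace ℝ H₂]

theorem norm_sq_linearCombination (v : ι → H₁) (c : ι →₀ ℝ) :
    ‖Finsupp.linearCombination ℝ v c‖ ^ 2 =
      ∑ i ∈ c.support, ∑ j ∈ c.support, c i * c j * inner ℝ (v i) (v j) := by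
  rw [← real_inner_self_eq_norm_sq, Finsupp.linearCombination_apply, Finsupp.sum, sum_inner]
  refine Finset.sum_congr rfl fun i _ => ?_
  rw [inner_sum]
  refine Finset.sum_congr rfl fun j _ => ?_
  rw [real_inner_smul_left, real_inner_smul_right, mul_assoc]

/-- Membership in the closed span of a subfamily depends only on the Gram matrix. -/
theorem mem_closure_span_image_of_inner_eq {v : ι → H₁} {w : ι → H₂}
    (h : ∀ i j, inner ℝ (v i) (v j) = inner ℝ (w i) (w j)) {s : Set ι} {i : ι}
    (hi : v i ∈ (Submodule.span ℝ (v '' s)).topologicalClosure) :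
    w i ∈ (Submodule.span ℝ (w '' s)).topologicalClosure := by
  have hnorm : ∀ c : ι →₀ ℝ,
      ‖Finsupp.linearCombination ℝ v c‖ = ‖Finsupp.linearCombination ℝ w c‖ := fun c => by
    rw [← sq_eq_sq₀ (norm_nonneg _) (norm_nonneg _), norm_sq_linearCombination,
      norm_sq_linearCombination]
    simp_rw [h]
  rw [← SetLike.mem_coe, Submodule.topologicalClosure_coe, Metric.mem_closure_iff] at hi ⊢
  intro ε hε
  obtain ⟨y, hy, hd⟩ := hi ε hε
  obtain ⟨c, hc, rfl⟩ := (Finsupp.mem_span_image_iff_linearCombination ℝ).1 hy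
  refine ⟨Finsupp.linearCombination ℝ w c,
    (Finsupp.mem_span_image_iff_linearCombination ℝ).2 ⟨c, hc, rfl⟩, ?_⟩
  -- The approximation error is itself a linear combination, so its norm is the same for both
  -- families.
  have := hnorm (Finsupp.single i 1 - c)
  simp only [map_sub, Finsupp.linearCombination_single, one_smul] at this
  rwa [dist_eq_norm, ← this, ← dist_eq_norm]

end Gram

/-! ### Analyticity of the exponential kernel -/

section ExpKernel

theorem summable_exp_kernel (β t : ℝ) :
    Summable fun n : ℕ => β ^ n / n.factorial * (t ^ n) ^ 2 := by
  refine (Real.summable_pow_div_factorial (β * t ^ 2)).congr fun n => ?_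
  rw [mul_pow]; ring

theorem memℓp_expVec {β : ℝ} (hβ : 0 ≤ β) (t : ℝ) :
    Memℓp (fun n : ℕ => √(β ^ n / n.factorial) * t ^ n) 2 := by
  refine memℓp_gen ?_
  refine (summable_exp_kernel β t).congr fun n => ?_
  have : 0 ≤ β ^ n / n.factorial := by positivity
  rw [ENNReal.toReal_ofNat, Real.rpow_ofNat, Real.norm_eq_abs, sq_abs, mul_pow, Real.sq_sqrt this]

/-- The feature vector in `ℓ²` of the kernel `exp (β t s)`. -/
noncomputable def expVec {β : ℝ} (hβ : 0 ≤ β) (t : ℝ) : lp (fun _ : ℕ => ℝ) 2 :=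
  ⟨_, memℓp_expVec hβ t⟩

theorem expVec_apply {β : ℝ} (hβ : 0 ≤ β) (t : ℝ) (n : ℕ) :
    expVec hβ t n = √(β ^ n / n.factorial) * t ^ n :=
  rfl

theorem inner_expVec {β : ℝ} (hβ : 0 ≤ β) (t s : ℝ) :
    inner ℝ (expVec hβ t) (expVec hβ s) = Real.exp (β * t * s) := by
  rw [lp.inner_eq_tsum, Real.exp_eq_exp_ℝ, NormedSpace.exp_eq_tsum_div]
  refine tsum_congr fun n => ?_
  have : 0 ≤ β ^ n / n.factorial := by positivity
  simp only [expVec_apply, RCLike.inner_apply, conj_trivial]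
  calc _ = (√(β ^ n / n.factorial) * √(β ^ n / n.factorial)) * (t ^ n * s ^ n) := by ring
    _ = _ := by rw [Real.mul_self_sqrt this, mul_pow, mul_pow]; ring

/-- The inner product is a power series in `t`. It converges absolutely at every real `t`, being an
inner product in `ℓ²`, so its radius is infinite. -/
theorem analyticOnNhd_inner_expVec {β : ℝ} (hβ : 0 ≤ β) (h : lp (fun _ : ℕ => ℝ) 2) :
    AnalyticOnNhd ℝ (fun t => inner ℝ h (expVec hβ t)) Set.univ := by
  let a : ℕ → ℝ := fun n => h n * √(β ^ n / n.factorial)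
  have hsum : ∀ r : ℝ, Summable fun n => ‖a n‖ * |r| ^ n := fun r => by
    have h1 : Summable fun n => inner ℝ (h n) (expVec hβ r n) :=
      lp.summable_inner (𝕜 := ℝ) h (expVec hβ r)
    refine h1.norm.congr fun n => ?_
    simp only [a, expVec_apply, RCLike.inner_apply, conj_trivial, norm_mul, norm_pow,
      Real.norm_eq_abs]
    ring
  have hrad : (FormalMultilinearSeries.ofScalars ℝ a).radius = ⊤ := by
    refine FormalMultilinearSeries.radius_eq_top_of_summable_norm _ fun r => ?_
    simpa using hsum r
  have := (FormalMultilinearSeries.ofScalars ℝ a).hasFPowerSeriesOnBall (by simp [hrad])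
  rw [hrad] at this
  have key : (FormalMultilinearSeries.ofScalars ℝ a).sum =
      fun t => inner ℝ h (expVec hβ t) := by
    funext t
    change FormalMultilinearSeries.ofScalarsSum a t = _
    rw [FormalMultilinearSeries.ofScalars_sum_eq, lp.inner_eq_tsum]
    refine tsum_congr fun n => ?_
    simp only [a, expVec_apply, RCLike.inner_apply, conj_trivial, smul_eq_mul]
    ring
  rw [key] at this
  have h2 := this.analyticOnNhd
  simpa using h2

/-- By the identity theorem, a vector orthogonal to the curve near `0` is orthogonal to the whole
curve; the closed span is the double orthogonal complement. -/
theorem expVec_mem_closure_span {β : ℝ} (hβ : 0 ≤ β) {s : Set ℝ} (hs : s ∈ 𝓝 (0 : ℝ)) (t : ℝ) :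
    expVec hβ t ∈ (Submodule.span ℝ (expVec hβ '' s)).topologicalClosure := by
  rw [← Submodule.orthogonal_orthogonal_eq_closure, Submodule.mem_orthogonal]
  intro h hh
  have : (fun t => inner ℝ h (expVec hβ t)) = fun _ => 0 := by
    refine AnalyticOnNhd.eq_of_eventuallyEq (analyticOnNhd_inner_expVec hβ h)
      analyticOnNhd_const (z₀ := 0) ?_
    filter_upwards [hs] with r hr
    rw [real_inner_comm]
    exact (Submodule.mem_orthogonal _ _).1 hh _ (Submodule.subset_span ⟨r, hr, rfl⟩)
  exact congrFun this t

/-- If the Gram matrix of a curve is a one-dimensional Gaussian kernel, then the whole curve lies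
in the closed span of any of its pieces around `0`. -/
theorem mem_closure_span_of_inner_eq_gaussian {H : Type*} [NormedAddCommGroup H]
    [InnerProductSpace ℝ H] {w : ℝ → H} {σ γ : ℝ} (hσ : 0 < σ) (hγ : 0 ≤ γ)
    (hw : ∀ t s, inner ℝ (w t) (w s) = σ ^ 2 * Real.exp (-γ * (t - s) ^ 2))
    {s : Set ℝ} (hs : s ∈ 𝓝 (0 : ℝ)) (t : ℝ) :
    w t ∈ (Submodule.span ℝ (w '' s)).topologicalClosure := by
  have hβ : 0 ≤ 2 * γ := by positivity
  have hc : ∀ r : ℝ, σ * Real.exp (-γ * r ^ 2) ≠ 0 := fun r => by positivity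
  -- Expanding `(t - s)²` factors the Gaussian as `e^{-γt²} e^{-γs²} e^{2γts}`, whence `β = 2γ` and
  -- the nonzero rescaling of `expVec`.
  refine mem_closure_span_image_of_inner_eq
    (v := fun r => (σ * Real.exp (-γ * r ^ 2)) • expVec hβ r) (fun r q => ?_) ?_
  · rw [real_inner_smul_left, real_inner_smul_right, inner_expVec, hw]
    calc _ = σ ^ 2 * (Real.exp (-γ * r ^ 2) * Real.exp (-γ * q ^ 2) *
          Real.exp (2 * γ * r * q)) := by ring
      _ = _ := by rw [← Real.exp_add, ← Real.exp_add]; ring_nf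
  · refine Submodule.smul_mem _ _ (Submodule.topologicalClosure_mono ?_
      (expVec_mem_closure_span hβ hs t))
    rw [Submodule.span_le]
    rintro _ ⟨r, hr, rfl⟩
    have : (σ * Real.exp (-γ * r ^ 2))⁻¹ • (σ * Real.exp (-γ * r ^ 2)) • expVec hβ r ∈
        Submodule.span ℝ ((fun r => (σ * Real.exp (-γ * r ^ 2)) • expVec hβ r) '' s) :=
      Submodule.smul_mem _ _ (Submodule.subset_span ⟨r, hr, rfl⟩)
    rwa [inv_smul_smul₀ (hc r)] at this

end ExpKernel

/-! ### Kriging variance as a distance in `L²` -/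

section SecondOrder

variable {d : ℕ} {Ω : Type*} [MeasurableSpace Ω] {P : Measure Ω}
  {ξ : EuclideanSpace ℝ (Fin d) → Ω → ℝ}

/-- The process viewed as a map into `L²(Ω, P)`. -/
noncomputable def toL2 (hξ : IsCenteredSecondOrder P ξ) (x : EuclideanSpace ℝ (Fin d)) :
    Lp ℝ 2 P :=
  (hξ.memLp x).toLp (ξ x)

theorem inner_toL2 (hξ : IsCenteredSecondOrder P ξ) (x y : EuclideanSpace ℝ (Fin d)) :
    inner ℝ (toL2 hξ x) (toL2 hξ y) = covFun P ξ x y := by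
  rw [L2.inner_def, covFun]
  refine integral_congr_ae ?_
  filter_upwards [(hξ.memLp x).coeFn_toLp, (hξ.memLp y).coeFn_toLp] with ω h1 h2
  simp only [toL2, h1, h2, RCLike.inner_apply, conj_trivial, mul_comm]

theorem norm_sq_Lp_two (f : Lp ℝ 2 P) : ‖f‖ ^ 2 = ∫ ω, f ω ^ 2 ∂P := by
  rw [← real_inner_self_eq_norm_sq, L2.inner_def]
  simp [sq]

theorem integral_eq_zero_of_mem_obsSpan [IsProbabilityMeasure P]
    (hξ : IsCenteredSecondOrder P ξ)
    (xs : ℕ → EuclideanSpace ℝ (Fin d)) (n : ℕ) {f : Lp ℝ 2 P} (hf : f ∈ obsSpan hξ xs n) :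
    ∫ ω, f ω ∂P = 0 := by
  have hint : ∀ g : Lp ℝ 2 P, Integrable g P := fun g =>
    (Lp.memLp g).integrable (by norm_num)
  induction hf using Submodule.span_induction with
  | mem g hg =>
    obtain ⟨i, rfl⟩ := hg
    rw [integral_congr_ae (hξ.memLp (xs i)).coeFn_toLp, hξ.mean_zero]
  | zero => rw [integral_congr_ae (Lp.coeFn_zero ℝ 2 P)]; simp
  | add f g _ _ h1 h2 =>
    rw [integral_congr_ae (Lp.coeFn_add f g)]
    simp only [Pi.add_apply]
    rw [integral_add (hint f) (hint g), h1, h2, add_zero]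
  | smul a f _ h1 =>
    rw [integral_congr_ae (Lp.coeFn_smul a f)]
    simp only [Pi.smul_apply]
    rw [integral_smul, h1, smul_zero]

theorem krigingVariance_eq_norm_sq [IsProbabilityMeasure P] (hξ : IsCenteredSecondOrder P ξ)
    (xs : ℕ → EuclideanSpace ℝ (Fin d)) (n : ℕ) (x : EuclideanSpace ℝ (Fin d)) :
    krigingVariance hξ xs n x =
      ‖toL2 hξ x - (obsSpan hξ xs n).starProjection (toL2 hξ x)‖ ^ 2 := by
  have hmem : krigingPredictor hξ xs n x ∈ obsSpan hξ xs n :=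
    Submodule.starProjection_apply_mem _ _
  have h2 : MemLp (fun ω => ξ x ω - krigingPredictor hξ xs n x ω) 2 P :=
    (hξ.memLp x).sub (Lp.memLp _)
  have h0 : ∫ ω, (ξ x ω - krigingPredictor hξ xs n x ω) ∂P = 0 := by
    rw [integral_sub ((hξ.memLp x).integrable (by norm_num))
      ((Lp.memLp _).integrable (by norm_num)), hξ.mean_zero,
      integral_eq_zero_of_mem_obsSpan hξ xs n hmem, sub_zero]
  rw [krigingVariance, variance_eq_integral h2.aestronglyMeasurable.aemeasurable, h0,
    norm_sq_Lp_two]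
  refine integral_congr_ae ?_
  filter_upwards [Lp.coeFn_sub (toL2 hξ x) (krigingPredictor hξ xs n x),
    (hξ.memLp x).coeFn_toLp] with ω h1 h2
  change _ = (toL2 hξ x - krigingPredictor hξ xs n x : Lp ℝ 2 P) ω ^ 2
  rw [h1, Pi.sub_apply, toL2, h2, sub_zero]

theorem iSup_obsSpan (hξ : IsCenteredSecondOrder P ξ) (xs : ℕ → EuclideanSpace ℝ (Fin d)) :
    ⨆ n, obsSpan hξ xs n = Submodule.span ℝ (toL2 hξ '' Set.range xs) := by
  apply le_antisymm
  · refine iSup_le fun n => Submodule.span_mono ?_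
    rintro _ ⟨i, rfl⟩
    exact ⟨_, ⟨i, rfl⟩, rfl⟩
  · rw [Submodule.span_le]
    rintro _ ⟨_, ⟨i, rfl⟩, rfl⟩
    exact Submodule.mem_iSup_of_mem (i + 1)
      (Submodule.subset_span ⟨⟨i, Nat.lt_succ_self i⟩, rfl⟩)

theorem monotone_obsSpan (hξ : IsCenteredSecondOrder P ξ) (xs : ℕ → EuclideanSpace ℝ (Fin d)) :
    Monotone (obsSpan hξ xs) := by
  intro m n hmn
  refine Submodule.span_mono ?_
  rintro _ ⟨i, rfl⟩
  exact ⟨Fin.castLE hmn i, rfl⟩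

/-- Projections onto increasing subspaces converge strongly to the projection onto the closure of
their union. -/
theorem tendsto_krigingVariance_iff [IsProbabilityMeasure P] (hξ : IsCenteredSecondOrder P ξ)
    (xs : ℕ → EuclideanSpace ℝ (Fin d)) (x : EuclideanSpace ℝ (Fin d)) :
    Tendsto (fun n => krigingVariance hξ xs n x) atTop (𝓝 0) ↔
      toL2 hξ x ∈ (Submodule.span ℝ (toL2 hξ '' Set.range xs)).topologicalClosure := by
  have hlim := Submodule.starProjection_tendsto_closure_iSup (obsSpan hξ xs)
    (monotone_obsSpan hξ xs) (toL2 hξ x)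
  simp_rw [krigingVariance_eq_norm_sq]
  rw [← iSup_obsSpan, ← Submodule.starProjection_eq_self_iff]
  have hlim2 := ((tendsto_const_nhds (x := toL2 hξ x)).sub hlim).norm.pow 2
  constructor
  · intro h
    have := tendsto_nhds_unique h hlim2
    rw [eq_comm, sq_eq_zero_iff, norm_eq_zero, sub_eq_zero] at this
    exact this.symm
  · intro h
    rw [h] at hlim2
    simpa using hlim2

theorem toL2_mem_closure_span_of_mem_closure {hξ : IsCenteredSecondOrder P ξ}
    (hc : Continuous (toL2 hξ)) {s : Set (EuclideanSpace ℝ (Fin d))}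
    {x : EuclideanSpace ℝ (Fin d)} (hx : x ∈ closure s) :
    toL2 hξ x ∈ (Submodule.span ℝ (toL2 hξ '' s)).topologicalClosure := by
  rw [← SetLike.mem_coe, Submodule.topologicalClosure_coe]
  exact closure_mono Submodule.subset_span (image_closure_subset_closure_image hc ⟨x, hx, rfl⟩)

theorem continuous_toL2 (hξ : IsCenteredSecondOrder P ξ)
    (hk : Continuous fun p : EuclideanSpace ℝ (Fin d) × EuclideanSpace ℝ (Fin d) =>
      covFun P ξ p.1 p.2) : Continuous (toL2 hξ) := by
  rw [continuous_iff_continuousAt]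
  intro x
  rw [ContinuousAt, tendsto_iff_norm_sub_tendsto_zero]
  have h : ∀ y, ‖toL2 hξ y - toL2 hξ x‖ =
      √(covFun P ξ y y - 2 * covFun P ξ y x + covFun P ξ x x) := fun y => by
    rw [← inner_toL2 hξ, ← inner_toL2 hξ, ← inner_toL2 hξ, real_inner_self_eq_norm_sq,
      real_inner_self_eq_norm_sq, ← norm_sub_sq_real, Real.sqrt_sq (norm_nonneg _)]
  simp_rw [h]
  have hcont : Continuous fun y => √(covFun P ξ y y - 2 * covFun P ξ y x + covFun P ξ x x) := by
    have h1 : Continuous fun y => covFun P ξ y y :=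
      hk.comp (continuous_id.prodMk continuous_id)
    have h2 : Continuous fun y => covFun P ξ y x :=
      hk.comp (continuous_id.prodMk continuous_const)
    fun_prop
  have := hcont.tendsto x
  convert this using 2
  rw [eq_comm, Real.sqrt_eq_zero']
  linarith

end SecondOrder

/-! ### Gaussian covariance -/

section Gaussian

variable {d : ℕ} {Ω : Type*} [MeasurableSpace Ω] {P : Measure Ω}
  {ξ : EuclideanSpace ℝ (Fin d) → Ω → ℝ} {s α : ℝ}

theorem continuous_toL2_of_gaussianCov (hξ : IsCenteredSecondOrder P ξ)
    (hk : ∀ x y, covFun P ξ x y = gaussianCov s α x y) : Continuous (toL2 hξ) := by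
  refine continuous_toL2 hξ ?_
  simp_rw [hk, gaussianCov]
  fun_prop

theorem toL2_mem_closure_span_of_gaussianCov (hξ : IsCenteredSecondOrder P ξ) (hs : 0 < s)
    (hα : 0 < α) (hk : ∀ x y, covFun P ξ x y = gaussianCov s α x y)
    {A : Set (EuclideanSpace ℝ (Fin d))} (hA : (interior (closure A)).Nonempty)
    (x : EuclideanSpace ℝ (Fin d)) :
    toL2 hξ x ∈ (Submodule.span ℝ (toL2 hξ '' A)).topologicalClosure := by
  obtain ⟨a, ha⟩ := hA
  -- Restricting to the line from `a` (parameter 0) to `x` (parameter 1) gives a one-dimensional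
  -- Gaussian kernel with `γ = α ‖x - a‖²`, possibly zero.
  let w : ℝ → Lp ℝ 2 P := fun t => toL2 hξ (a + t • (x - a))
  have hw : ∀ t r, inner ℝ (w t) (w r) =
      s ^ 2 * Real.exp (-(α * ‖x - a‖ ^ 2) * (t - r) ^ 2) := fun t r => by
    simp only [w]
    rw [inner_toL2, hk, gaussianCov, add_sub_add_left_eq_sub, ← sub_smul, norm_smul, mul_pow,
      Real.norm_eq_abs, sq_abs]
    ring_nf
  have hnhds : (fun t : ℝ => a + t • (x - a)) ⁻¹' closure A ∈ 𝓝 (0 : ℝ) := by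
    have hcont : Continuous fun t : ℝ => a + t • (x - a) := by fun_prop
    refine hcont.continuousAt.preimage_mem_nhds ?_
    simpa using mem_interior_iff_mem_nhds.1 ha
  have h1 := mem_closure_span_of_inner_eq_gaussian hs (by positivity) hw hnhds 1
  have h2 : toL2 hξ x = w 1 := by simp [w]
  rw [h2]
  refine Submodule.topologicalClosure_minimal _ ?_ (Submodule.isClosed_topologicalClosure _) h1
  rw [Submodule.span_le]
  rintro _ ⟨t, ht, rfl⟩
  exact toL2_mem_closure_span_of_mem_closure (continuous_toL2_of_gaussianCov hξ hk) ht

theorem not_noEmptyBall_of_gaussianCov [IsProbabilityMeasure P] (hd : 1 ≤ d)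
    (hξ : IsCenteredSecondOrder P ξ) (hs : 0 < s) (hα : 0 < α)
    (hk : ∀ x y, covFun P ξ x y = gaussianCov s α x y) : ¬ NoEmptyBall hξ := by
  intro h
  have : Nonempty (Fin d) := ⟨⟨0, hd⟩⟩
  -- Counterexample: observations dense in the unit ball also predict perfectly at a point outside
  -- it.
  let B : Set (EuclideanSpace ℝ (Fin d)) := Metric.closedBall 0 1
  have : Nonempty B := ⟨⟨0, by simp [B]⟩⟩
  let xs : ℕ → EuclideanSpace ℝ (Fin d) := fun n => (TopologicalSpace.denseSeq B n : B)
  have hcl : closure (Set.range xs) = B := by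
    have h1 : Set.range xs = Subtype.val '' Set.range (TopologicalSpace.denseSeq B) := by
      rw [← Set.range_comp]; rfl
    apply Set.Subset.antisymm
    · refine closure_minimal ?_ Metric.isClosed_closedBall
      rintro _ ⟨n, rfl⟩
      exact (TopologicalSpace.denseSeq B n).2
    · intro y hy
      rw [h1]
      exact image_closure_subset_closure_image continuous_subtype_val
        ⟨⟨y, hy⟩, TopologicalSpace.denseRange_denseSeq B _, rfl⟩
  have hint : (interior (closure (Set.range xs))).Nonempty := by
    rw [hcl]
    exact ⟨0, mem_interior_iff_mem_nhds.2 (Metric.closedBall_mem_nhds _ one_pos)⟩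
  obtain ⟨y, hy⟩ := NormedSpace.exists_lt_norm ℝ (EuclideanSpace ℝ (Fin d)) 1
  have := (h xs y).2 ((tendsto_krigingVariance_iff hξ xs y).2
    (toL2_mem_closure_span_of_gaussianCov hξ hs hα hk hint y))
  rw [hcl] at this
  simp [B] at this
  linarith

end Gaussian

/-! ### Spectral densities with polynomially bounded inverse -/

section Spectral

variable {d : ℕ}

/-- The trigonometric polynomial `u ↦ ∑ c_y e^{i⟨u, y⟩}`. -/
noncomputable def trigPoly (c : EuclideanSpace ℝ (Fin d) →₀ ℝ) (u : EuclideanSpace ℝ (Fin d)) :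
    ℂ :=
  Finsupp.linearCombination ℝ
    (fun y => Complex.exp (Complex.I * (inner ℝ u y : ℝ))) c

theorem trigPoly_eq_sum (c : EuclideanSpace ℝ (Fin d) →₀ ℝ) (u : EuclideanSpace ℝ (Fin d)) :
    trigPoly c u =
      ∑ y ∈ c.support, (c y : ℂ) * Complex.exp (Complex.I * (inner ℝ u y : ℝ)) := by
  simp [trigPoly, Finsupp.linearCombination_apply, Finsupp.sum]

theorem norm_exp_I_inner (u y : EuclideanSpace ℝ (Fin d)) :
    ‖Complex.exp (Complex.I * (inner ℝ u y : ℝ))‖ = 1 := by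
  rw [mul_comm, Complex.norm_exp_ofReal_mul_I]

theorem integrable_exp_I_inner_mul (y : EuclideanSpace ℝ (Fin d))
    {f : EuclideanSpace ℝ (Fin d) → ℂ} (hf : Integrable f) :
    Integrable fun u => Complex.exp (Complex.I * (inner ℝ u y : ℝ)) * f u := by
  refine hf.bdd_mul (c := 1) ?_ ?_
  · exact Continuous.aestronglyMeasurable (by fun_prop)
  · exact .of_forall fun u => (norm_exp_I_inner u y).le

theorem norm_sq_trigPoly (c : EuclideanSpace ℝ (Fin d) →₀ ℝ) (u : EuclideanSpace ℝ (Fin d)) :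
    ((‖trigPoly c u‖ ^ 2 : ℝ) : ℂ) = ∑ x ∈ c.support, ∑ y ∈ c.support,
      (c x * c y : ℂ) * Complex.exp (Complex.I * (inner ℝ u (x - y) : ℝ)) := by
  push_cast
  rw [← Complex.mul_conj', trigPoly_eq_sum, map_sum, Finset.sum_mul_sum]
  refine Finset.sum_congr rfl fun x _ => Finset.sum_congr rfl fun y _ => ?_
  rw [map_mul, Complex.conj_ofReal, ← Complex.exp_conj, map_mul, Complex.conj_I,
    Complex.conj_ofReal, mul_mul_mul_comm, ← Complex.exp_add, inner_sub_right]
  push_cast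
  ring_nf

variable {Ω : Type*} [MeasurableSpace Ω] {P : Measure Ω}
  {ξ : EuclideanSpace ℝ (Fin d) → Ω → ℝ} {S : EuclideanSpace ℝ (Fin d) → ℝ}

theorem integrable_norm_sq_trigPoly_mul (hS : Integrable S)
    (c : EuclideanSpace ℝ (Fin d) →₀ ℝ) :
    Integrable fun u => ‖trigPoly c u‖ ^ 2 * S u := by
  have h : Integrable fun u => (((‖trigPoly c u‖ ^ 2 * S u : ℝ)) : ℂ) := by
    simp_rw [Complex.ofReal_mul, norm_sq_trigPoly, Finset.sum_mul, mul_assoc]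
    refine integrable_finsetSum _ fun x _ => integrable_finsetSum _ fun y _ => ?_
    exact ((integrable_exp_I_inner_mul _ hS.ofReal).const_mul _).const_mul _
  exact h.re

/-- The isometry between the span of the process and trigonometric polynomials in `L²(S)`. -/
theorem integral_norm_sq_trigPoly_mul (hξ : IsCenteredSecondOrder P ξ)
    (hS : IsSpectralDensity (covFun P ξ) S) (c : EuclideanSpace ℝ (Fin d) →₀ ℝ) :
    ∫ u, ‖trigPoly c u‖ ^ 2 * S u =
      (2 * Real.pi) ^ d * ‖Finsupp.linearCombination ℝ (toL2 hξ) c‖ ^ 2 := by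
  have hpi : ((2 * Real.pi) ^ d : ℝ) ≠ 0 := by positivity
  have hk : ∀ x y, ∫ u, Complex.exp (Complex.I * (inner ℝ u (x - y) : ℝ)) * (S u : ℂ) =
      (((2 * Real.pi) ^ d * covFun P ξ x y : ℝ) : ℂ) := fun x y => by
    rw [Complex.ofReal_mul, hS.eq_integral, ← mul_assoc, ← Complex.ofReal_mul,
      mul_inv_cancel₀ hpi, Complex.ofReal_one, one_mul]
  have hint : ∀ x y : EuclideanSpace ℝ (Fin d), Integrable fun u => (c x : ℂ) * ((c y : ℂ) *
      (Complex.exp (Complex.I * (inner ℝ u (x - y) : ℝ)) * (S u : ℂ))) := fun x y =>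
    ((integrable_exp_I_inner_mul _ hS.integrable.ofReal).const_mul _).const_mul _
  rw [← Complex.ofReal_inj, ← integral_complex_ofReal, norm_sq_linearCombination]
  simp_rw [Complex.ofReal_mul _ (S _), norm_sq_trigPoly, Finset.sum_mul, mul_assoc]
  rw [integral_finsetSum _ fun x _ => integrable_finsetSum _ fun y _ => hint x y]
  rw [Finset.mul_sum, Complex.ofReal_sum]
  refine Finset.sum_congr rfl fun x _ => ?_
  rw [integral_finsetSum _ fun y _ => hint x y, Finset.mul_sum, Complex.ofReal_sum]
  refine Finset.sum_congr rfl fun y _ => ?_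
  rw [integral_const_mul, integral_const_mul, hk, inner_toL2]
  push_cast
  ring

theorem continuous_toL2_of_isSpectralDensity (hξ : IsCenteredSecondOrder P ξ)
    (hS : IsSpectralDensity (covFun P ξ) S) : Continuous (toL2 hξ) := by
  refine continuous_toL2 hξ ?_
  have h : Continuous fun p : EuclideanSpace ℝ (Fin d) × EuclideanSpace ℝ (Fin d) =>
      (covFun P ξ p.1 p.2 : ℂ) := by
    simp_rw [hS.eq_integral]
    refine continuous_const.mul ?_
    refine continuous_of_dominated (bound := fun u => ‖S u‖) (fun p => ?_) (fun p => ?_)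
      hS.integrable.norm ?_
    · exact (integrable_exp_I_inner_mul _ hS.integrable.ofReal).aestronglyMeasurable
    · refine .of_forall fun u => ?_
      rw [norm_mul, norm_exp_I_inner, one_mul, Complex.norm_real]
    · refine .of_forall fun u => ?_
      fun_prop
  exact Complex.continuous_re.comp h

/-- Smooth bumps are superpositions of plane waves with a Schwartz amplitude. -/
theorem exists_schwartz_integral_exp_eq_bump (x : EuclideanSpace ℝ (Fin d)) {ε : ℝ} (hε : 0 < ε) :
    ∃ g : SchwartzMap (EuclideanSpace ℝ (Fin d)) ℂ,
      (∫ u, Complex.exp (Complex.I * (inner ℝ u x : ℝ)) * g u = 1) ∧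
      ∀ y, ε ≤ dist y x → ∫ u, Complex.exp (Complex.I * (inner ℝ u y : ℝ)) * g u = 0 := by
  have h2pi : 0 < 2 * Real.pi := by positivity
  -- Centre and radii are divided by `2π` to pass from the kernel `e^{2πi⟨u, y⟩}` of the Fourier
  -- transform to `e^{i⟨u, y⟩}`.
  let b : ContDiffBump ((2 * Real.pi)⁻¹ • x) :=
    ⟨ε / (2 * Real.pi) / 2, ε / (2 * Real.pi), by positivity, half_lt_self (by positivity)⟩
  have hsm : ContDiff ℝ (⊤ : ℕ∞) fun y => (b y : ℂ) := Complex.ofRealCLM.contDiff.comp b.contDiff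
  have hcs : HasCompactSupport fun y => (b y : ℂ) :=
    b.hasCompactSupport.comp_left (g := fun r : ℝ => (r : ℂ)) Complex.ofReal_zero
  let f : SchwartzMap (EuclideanSpace ℝ (Fin d)) ℂ := hcs.toSchwartzMap hsm
  have key : ∀ y, ∫ u, Complex.exp (Complex.I * (inner ℝ u y : ℝ)) *
      (FourierTransform.fourier f) u = (b ((2 * Real.pi)⁻¹ • y) : ℂ) := fun y => by
    have h1 : FourierTransformInv.fourierInv (FourierTransform.fourier f) = f :=
      FourierTransform.fourierInv_fourier_eq f
    have h2 : (FourierTransformInv.fourierInv (FourierTransform.fourier f))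
        ((2 * Real.pi)⁻¹ • y) = (b ((2 * Real.pi)⁻¹ • y) : ℂ) := by rw [h1]; rfl
    rw [SchwartzMap.fourierInv_coe, Real.fourierInv_eq'] at h2
    rw [← h2]
    refine integral_congr_ae (.of_forall fun u => ?_)
    simp only [smul_eq_mul]
    rw [real_inner_smul_right, mul_inv_cancel_left₀ h2pi.ne', mul_comm Complex.I]
  refine ⟨FourierTransform.fourier f, ?_, fun y hy => ?_⟩
  · rw [key, b.one_of_mem_closedBall (by simpa using b.rIn_pos.le), Complex.ofReal_one]
  · rw [key, b.zero_of_le_dist, Complex.ofReal_zero]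
    rw [dist_smul₀, norm_inv, Real.norm_of_nonneg h2pi.le, inv_mul_eq_div]
    exact div_le_div_of_nonneg_right hy h2pi.le

theorem integrable_norm_sq_mul_one_add_pow (g : SchwartzMap (EuclideanSpace ℝ (Fin d)) ℂ)
    (r : ℕ) : Integrable fun u => ‖g u‖ ^ 2 * (1 + ‖u‖ ^ r) := by
  have h : Integrable fun u => ‖u‖ ^ 0 * ‖g u‖ + ‖u‖ ^ r * ‖g u‖ :=
    (g.integrable_pow_mul volume 0).add (g.integrable_pow_mul volume r)
  obtain ⟨M, hM⟩ : ∃ M, ∀ u, ‖g u‖ ≤ M := by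
    obtain ⟨M, -, hM⟩ := g.decay 0 0
    exact ⟨M, fun u => by simpa using hM u⟩
  refine (h.bdd_mul (f := fun u => ‖g u‖) (c := M) ?_ (.of_forall fun u => ?_)).congr
    (.of_forall fun u => ?_)
  · exact g.continuous.norm.aestronglyMeasurable
  · simpa using hM u
  · simp only [pow_zero]; ring

/-- Weighted AM–GM: after replacing `s` by its lower bound `C / w`, the difference is a perfect
square over a positive number. Its integral serves as Cauchy–Schwarz with free parameter `t`. -/
theorem two_mul_le_of_le_mul {p q s w C t : ℝ} (hC : 0 < C) (ht : 0 < t) (hw : 0 < w)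
    (h : C ≤ s * w) : p * q ≤ t / (2 * C) * (p ^ 2 * w) + 1 / (2 * t) * (q ^ 2 * s) := by
  have h1 : C / w ≤ s := by rwa [div_le_iff₀ hw]
  have h2 : 1 / (2 * t) * (q ^ 2 * (C / w)) ≤ 1 / (2 * t) * (q ^ 2 * s) := by gcongr
  have h3 : t / (2 * C) * (p ^ 2 * w) + 1 / (2 * t) * (q ^ 2 * (C / w)) - p * q =
      (t * w * p - C * q) ^ 2 / (2 * C * t * w) := by
    field_simp
    ring
  have h4 : 0 ≤ (t * w * p - C * q) ^ 2 / (2 * C * t * w) := by positivity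
  linarith

/-- Prediction errors from observations outside a ball are bounded away from zero. -/
theorem exists_pos_le_norm_sq_sub_linearCombination (hξ : IsCenteredSecondOrder P ξ)
    (hS : IsSpectralDensity (covFun P ξ) S) (hg : InvPolynomialGrowth S)
    (x : EuclideanSpace ℝ (Fin d)) {ε : ℝ} (hε : 0 < ε) :
    ∃ κ : ℝ, 0 < κ ∧ ∀ c : EuclideanSpace ℝ (Fin d) →₀ ℝ, (∀ y ∈ c.support, ε ≤ dist y x) →
      κ ≤ ‖toL2 hξ x - Finsupp.linearCombination ℝ (toL2 hξ) c‖ ^ 2 := by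
  obtain ⟨C, hC, r, -, hCS⟩ := hg
  obtain ⟨g, hgx, hgy⟩ := exists_schwartz_integral_exp_eq_bump x hε
  set A : ℝ := ∫ u, ‖g u‖ ^ 2 * (1 + ‖u‖ ^ r)
  have hA : 0 ≤ A := integral_nonneg fun u => by positivity
  -- With this `t` the term in `A` is at most `1/2`, leaving `1/2` for the prediction error; the `+
  -- 1` spares proving `A ≠ 0`.
  set t : ℝ := C / (A + 1)
  have ht : 0 < t := by positivity
  have hB : (0 : ℝ) < (2 * Real.pi) ^ d := by positivity
  refine ⟨t / (2 * Real.pi) ^ d, by positivity, fun c hc => ?_⟩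
  set c' : EuclideanSpace ℝ (Fin d) →₀ ℝ := Finsupp.single x 1 - c
  have hnorm := integral_norm_sq_trigPoly_mul hξ hS c'
  have hlin : Finsupp.linearCombination ℝ (toL2 hξ) c' =
      toL2 hξ x - Finsupp.linearCombination ℝ (toL2 hξ) c := by simp [c']
  rw [hlin] at hnorm
  -- Pairing with `g` evaluates the bump at the points of `c'`: only the unit mass at `x`
  -- contributes.
  have hone : ∫ u, g u * trigPoly c' u = 1 := by
    have h1 : ∫ u, g u * trigPoly c' u = Finsupp.linearCombination ℝ
        (fun y => ∫ u, Complex.exp (Complex.I * (inner ℝ u y : ℝ)) * g u) c' := by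
      simp_rw [trigPoly_eq_sum, Finset.mul_sum]
      rw [integral_finsetSum, Finsupp.linearCombination_apply, Finsupp.sum]
      · refine Finset.sum_congr rfl fun y _ => ?_
        rw [Complex.real_smul, ← integral_const_mul]
        refine integral_congr_ae (.of_forall fun u => ?_)
        simp only
        ring
      · intro y _
        refine ((integrable_exp_I_inner_mul y g.integrable).const_mul (c' y : ℂ)).congr
          (.of_forall fun u => ?_)
        simp only
        ring
    rw [h1, map_sub, Finsupp.linearCombination_single, hgx,
      Finsupp.linearCombination_apply, Finsupp.sum, Finset.sum_eq_zero, one_smul, sub_zero]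
    intro y hy
    rw [hgy y (hc y hy), smul_zero]
  have hi1 := (integrable_norm_sq_mul_one_add_pow g r).const_mul (t / (2 * C))
  have hi2 := (integrable_norm_sq_trigPoly_mul hS.integrable c').const_mul (1 / (2 * t))
  have hle : (1 : ℝ) ≤ t / (2 * C) * A + 1 / (2 * t) * ((2 * Real.pi) ^ d *
      ‖toL2 hξ x - Finsupp.linearCombination ℝ (toL2 hξ) c‖ ^ 2) := by
    calc (1 : ℝ) = ‖∫ u, g u * trigPoly c' u‖ := by rw [hone, norm_one]
      _ ≤ ∫ u, (t / (2 * C) * (‖g u‖ ^ 2 * (1 + ‖u‖ ^ r)) +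
          1 / (2 * t) * (‖trigPoly c' u‖ ^ 2 * S u)) := by
        refine norm_integral_le_of_norm_le (hi1.add hi2) ?_
        filter_upwards [hCS] with u hu
        rw [norm_mul]
        exact two_mul_le_of_le_mul hC ht (by positivity) hu
      _ = _ := by
        rw [integral_add hi1 hi2, integral_const_mul, integral_const_mul, hnorm]
  have h1 : t / (2 * C) * A ≤ 1 / 2 := by
    have : t / (2 * C) * A = (A / (A + 1)) * (1 / 2) := by
      simp only [t]; field_simp
    rw [this]
    have : A / (A + 1) ≤ 1 := by rw [div_le_one (by positivity)]; linarith
    linarith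
  rw [div_le_iff₀ hB]
  have h2 : 1 / 2 ≤ 1 / (2 * t) * ((2 * Real.pi) ^ d *
      ‖toL2 hξ x - Finsupp.linearCombination ℝ (toL2 hξ) c‖ ^ 2) := by linarith
  rw [one_div_mul_eq_div, le_div_iff₀ (by positivity)] at h2
  linarith

theorem noEmptyBall_of_isSpectralDensity [IsProbabilityMeasure P]
    (hξ : IsCenteredSecondOrder P ξ) (hS : IsSpectralDensity (covFun P ξ) S)
    (hg : InvPolynomialGrowth S) : NoEmptyBall hξ := by
  intro xs x
  rw [tendsto_krigingVariance_iff]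
  refine ⟨toL2_mem_closure_span_of_mem_closure (continuous_toL2_of_isSpectralDensity hξ hS),
    fun h => ?_⟩
  by_contra hx
  rw [Metric.mem_closure_iff] at hx
  push Not at hx
  obtain ⟨ε, hε, hx⟩ := hx
  obtain ⟨κ, hκ, hle⟩ := exists_pos_le_norm_sq_sub_linearCombination hξ hS hg x hε
  rw [← SetLike.mem_coe, Submodule.topologicalClosure_coe, Metric.mem_closure_iff] at h
  obtain ⟨y, hy, hd⟩ := h (√κ) (Real.sqrt_pos.2 hκ)
  obtain ⟨c, hc, rfl⟩ := (Finsupp.mem_span_image_iff_linearCombination ℝ).1 hy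
  have h1 := hle c fun z hz => by
    rw [dist_comm]
    exact hx z (hc hz)
  rw [dist_eq_norm, Real.lt_sqrt (norm_nonneg _)] at hd
  linarith

end Spectral

end Kriging

theorem proposition1 {d : ℕ} (hd : 1 ≤ d) {Ω : Type*} [MeasurableSpace Ω]
    (P : Measure Ω) [IsProbabilityMeasure P]
    (ξ : EuclideanSpace ℝ (Fin d) → Ω → ℝ) (hξ : Kriging.IsCenteredSecondOrder P ξ) :
    (Kriging.IsStationaryCov (Kriging.covFun P ξ) →
      (∃ S : EuclideanSpace ℝ (Fin d) → ℝ,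
        Kriging.IsSpectralDensity (Kriging.covFun P ξ) S ∧ Kriging.InvPolynomialGrowth S) →
      Kriging.NoEmptyBall hξ) ∧
    (∀ s α : ℝ, 0 < s → 0 < α →
      (∀ x y, Kriging.covFun P ξ x y = Kriging.gaussianCov s α x y) →
      ¬ Kriging.NoEmptyBall hξ ∧
      ∀ xs : ℕ → EuclideanSpace ℝ (Fin d),
        (interior (closure (Set.range xs))).Nonempty →
        ∀ x, Tendsto (fun n => Kriging.krigingVariance hξ xs n x) atTop (𝓝 0)) := by
  refine ⟨fun _ ⟨_, hS, hg⟩ => Kriging.noEmptyBall_of_isSpectralDensity hξ hS hg,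
    fun s α hs hα hk => ⟨Kriging.not_noEmptyBall_of_gaussianCov hd hξ hs hα hk,
      fun xs hxs x => ?_⟩⟩
  exact (Kriging.tendsto_krigingVariance_iff hξ xs x).2
    (Kriging.toL2_mem_closure_span_of_gaussianCov hξ hs hα hk hxs x)
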